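/- Let $\Psi_T=\frac1{\sqrt T}\sum_{i=0}^{T-1}|i\rangle|i\rangle\in\mathbb C^T\otimes\mathbb C^T$, and for a density matrix $\sigma$ on $\mathbb C^T\otimes\mathbb C^T$ let $F(\sigma)=\langle\Psi_T|\sigma|\Psi_T\rangle$ be its fidelity. A general entanglement purification protocol (GEPP) $\mathcal P$ takes a bipartite state $\rho$ on $\mathbb C^N\otimes\mathbb C^N$ shared by Alice and Bob, together with the auxiliary state $\Psi_K$; Alice and Bob then perform finitely many rounds of local quantum operations and classical communication (LOCC), with finitely many outcomes and finite-dimensional local systems, and either output the symbol FAIL or output a (possibly mixed) state $\mathcal P(\rho)$ on $\mathbb C^M\otimes\mathbb C^M$. At the end they may keep a part of the classical information produced during the protocol; $\mathcal P(\rho)$ is the mixture over everything that is not kept, so it is a random variable depending on the kept part only. Call $\mathcal P$ absolutely successful with parameter $\langle N,K,M,\epsilon,\delta\rangle$ if for every state $\rho$ with $F(\rho)\ge 1-\epsilon$ we have $\Pr[\mathcal P(\rho)=\mathrm{FAIL}]=0$ and $\Pr[F(\mathcal P(\rho))\ge 1-\delta]=1$. Let $N\ge 2$ and $K,M\ge 1$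 be integers. (a) Let $0\le\epsilon\le 1-\frac1N$ and let $\delta$ be real. If some GEPP is absolutely successful with parameter $\langle N,K,M,\epsilon,\delta\rangle$, then $$\delta\ \ge\ \frac{M-K}{M}\cdot\frac{N}{N-1}\,\epsilon .$$ (b) The bound in (a) is tight: if $NK/M$ and $M/K$ are both integers, then there is a GEPP (one and the same for all $\epsilon\ge 0$) that is absolutely successful with parameter $\left\langle N,K,M,\epsilon,\frac{M-K}{M}\cdot\frac{N}{N-1}\,\epsilon\right\rangle$. -/

import Mathlib

open scoped Matrix Kronecker BigOperators ComplexOrder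

namespace Purification

/-- Operators on the bipartite space `ℂ^a ⊗ ℂ^b`; the first factor belongs to Alice, the second one
to Bob. -/
abbrev BiOp (a b : ℕ) : Type := Matrix (Fin a × Fin b) (Fin a × Fin b) ℂ

/-- A (possibly mixed) state, given by its density matrix. -/
def IsState {a b : ℕ} (ρ : BiOp a b) : Prop :=
  ρ.PosSemidef ∧ ρ.trace = 1

/-- The maximally entangled vector `Ψ_T = T^(-1/2) ∑ i, |i⟩|i⟩` in `ℂ^T ⊗ ℂ^T`. -/
noncomputable def maxEnt (T : ℕ) : Fin T × Fin T → ℂ :=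
  fun p => if p.1 = p.2 then ((1 / Real.sqrt T : ℝ) : ℂ) else 0

/-- The projector `|Ψ_T⟩⟨Ψ_T|`. -/
noncomputable def maxEntState (T : ℕ) : BiOp T T :=
  Matrix.vecMulVec (maxEnt T) (star (maxEnt T))

/-- The fidelity `⟨Ψ_T| ρ |Ψ_T⟩` of `ρ` with the maximally entangled state. -/
noncomputable def fidelity {T : ℕ} (ρ : BiOp T T) : ℝ :=
  (star (maxEnt T) ⬝ᵥ (ρ *ᵥ maxEnt T)).re

/-- A local quantum instrument from dimension `d` to dimension `d'` with `m` classical outcomes: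
for each outcome a completely positive map (in Kraus form), these maps adding up to a trace
preserving one. It covers unitaries, (general) measurements, introducing ancillas, discarding
subsystems, classical randomness, and all combinations of these. -/
structure Instrument (d d' m : ℕ) where
  numKraus : ℕ
  kraus : Fin m → Fin numKraus → Matrix (Fin d') (Fin d) ℂ
  complete : ∑ i, ∑ k, (kraus i k)ᴴ * kraus i k = 1

/-- The unnormalised state after Alice applies `E` to her part and observes outcome `i`. -/
noncomputable def Instrument.onAlice {a a' m b : ℕ} (E : Instrument a a' m) (i : Fin m)
    (ρ : BiOp a b) : BiOp a' b :=
  ∑ k, (E.kraus i k ⊗ₖ (1 : Matrix (Fin b) (Fin b) ℂ)) * ρ *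
    (E.kraus i k ⊗ₖ (1 : Matrix (Fin b) (Fin b) ℂ))ᴴ

/-- The unnormalised state after Bob applies `E` to his part and observes outcome `i`. -/
noncomputable def Instrument.onBob {a b b' m : ℕ} (E : Instrument b b' m) (i : Fin m)
    (ρ : BiOp a b) : BiOp a b' :=
  ∑ k, ((1 : Matrix (Fin a) (Fin a) ℂ) ⊗ₖ E.kraus i k) * ρ *
    ((1 : Matrix (Fin a) (Fin a) ℂ) ⊗ₖ E.kraus i k)ᴴ

/-- LOCC protocols that start on `ℂ^a ⊗ ℂ^b` and either output `FAIL` or output a state of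
`ℂ^M ⊗ ℂ^M`. In each step one of the parties applies a local instrument and communicates its
outcome; the rest of the protocol may depend on the outcome. An output comes with a classical record
`j : Fin r`, which is all the classical information that is kept at the end: branches with the same
record are mixed. -/
inductive LOCC (M r : ℕ) : ℕ → ℕ → Type
  | fail (a b : ℕ) : LOCC M r a b
  | output (j : Fin r) : LOCC M r M M
  | alice {a b : ℕ} (a' m : ℕ) (E : Instrument a a' m) (next : Fin m → LOCC M r a' b) :
      LOCC M r a b
  | bob {a b : ℕ} (b' m : ℕ) (E : Instrument b b' m) (next : Fin m → LOCC M r a b') :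
      LOCC M r a b

namespace LOCC

variable {M r : ℕ}

/-- The probability that the protocol outputs `FAIL` on input `ρ`. -/
noncomputable def failProb : {a b : ℕ} → LOCC M r a b → BiOp a b → ℝ
  | _, _, fail _ _, ρ => ρ.trace.re
  | _, _, output _, _ => 0
  | _, _, alice _ _ E next, ρ => ∑ i, (next i).failProb (E.onAlice i ρ)
  | _, _, bob _ _ E next, ρ => ∑ i, (next i).failProb (E.onBob i ρ)

/-- The unnormalised state that the protocol outputs together with the record `j` on input `ρ`. -/
noncomputable def branch (j : Fin r) : {a b : ℕ} → LOCC M r a b → BiOp a b → BiOp M M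
  | _, _, fail _ _, _ => 0
  | _, _, output j', ρ => if j' = j then ρ else 0
  | _, _, alice _ _ E next, ρ => ∑ i, branch j (next i) (E.onAlice i ρ)
  | _, _, bob _ _ E next, ρ => ∑ i, branch j (next i) (E.onBob i ρ)

/-- The probability that the protocol outputs a state together with the record `j`. -/
noncomputable def outProb {a b : ℕ} (P : LOCC M r a b) (ρ : BiOp a b) (j : Fin r) : ℝ :=
  (P.branch j ρ).trace.re

/-- The (normalised) state that the protocol outputs, given that the record is `j`. -/
noncomputable def outState {a b : ℕ} (P : LOCC M r a b) (ρ : BiOp a b) (j : Fin r) : BiOp M M :=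
  ((P.outProb ρ j)⁻¹ : ℝ) • P.branch j ρ

end LOCC

/-- The joint state `ρ ⊗ |Ψ_K⟩⟨Ψ_K|`, Alice and Bob each holding `ℂ^N ⊗ ℂ^K = ℂ^(N * K)`. -/
noncomputable def withAux {N : ℕ} (K : ℕ) (ρ : BiOp N N) : BiOp (N * K) (N * K) :=
  (ρ ⊗ₖ maxEntState K).submatrix
    (fun p => ((p.1.divNat, p.2.divNat), (p.1.modNat, p.2.modNat)))
    (fun p => ((p.1.divNat, p.2.divNat), (p.1.modNat, p.2.modNat)))

/-- A general entanglement purification protocol: an LOCC protocol whose input is a state of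
`ℂ^N ⊗ ℂ^N` together with the auxiliary state `Ψ_K`. -/
structure GEPP (N K M : ℕ) where
  numRecords : ℕ
  locc : LOCC M numRecords (N * K) (N * K)

namespace GEPP

variable {N K M : ℕ}

/-- The probability that the protocol outputs `FAIL` on input `ρ`. -/
noncomputable def probFail (P : GEPP N K M) (ρ : BiOp N N) : ℝ :=
  P.locc.failProb (withAux K ρ)

/-- The probability that on input `ρ` the protocol outputs a state of fidelity at least `f`. -/
noncomputable def probFidelityGE (P : GEPP N K M) (ρ : BiOp N N) (f : ℝ) : ℝ :=
  ∑ j, if f ≤ fidelity (P.locc.outState (withAux K ρ) j) then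
    P.locc.outProb (withAux K ρ) j else 0

/-- `P` is absolutely successful with parameter `⟨N, K, M, ε, δ⟩`. -/
def AbsolutelySuccessful (P : GEPP N K M) (ε δ : ℝ) : Prop :=
  ∀ ρ : BiOp N N, IsState ρ → 1 - ε ≤ fidelity ρ →
    P.probFail ρ = 0 ∧ P.probFidelityGE ρ (1 - δ) = 1

end GEPP

end Purification

/-! Both halves are governed by the expected fidelity of the output, `LOCC.outFidelity`, which is
linear in the input.

For (a), absolute success forces this expectation to be at least 1 - δ. Kraus operators of Alice and
Bob multiply the coefficient matrix of a pure state from the left and from the right, so no branch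
of an LOCC protocol raises the Schmidt rank. A unit vector of Schmidt rank s has squared overlap at
most s/M with Ψ_M (`norm_trace_sq_le_rank_mul`). Hence a product state accompanied by Ψ_K, of
Schmidt rank at most K, reaches at most K/M (`LOCC.outFidelity_pureOp_le`). Mixing Ψ_N with a
product state, with as much weight as F ≥ 1 - ε permits, gives the bound by linearity.

For (b), put M = LK and N = LQ. Leave Ψ_K untouched (`LOCC.outFidelity_lift`) and compress N to L:
choose a random partition of the N basis labels into Q blocks of size L, let Alice measure her block
and Bob test whether he is in the same one, and on disagreement substitute a product state, of
fidelity 1/L. Coherences inside a block survive, and two distinct labels share a block with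
probability (L-1)/(N-1) (`sum_same_block`). The mean output fidelity is therefore affine in F(ρ) for
every state ρ (`outFidelity_blockProtocol`), with exactly the slope of (a). Discarding all classical
information turns this mean into the fidelity of the actual output. -/

namespace Purification

section Basic

variable {a a' b b' m M r : ℕ}

/-! ### Linearity of branches and fidelity in the input -/

section Linearity

theorem Instrument.onAlice_add (E : Instrument a a' m) (i : Fin m) (ρ σ : BiOp a b) :
    E.onAlice i (ρ + σ) = E.onAlice i ρ + E.onAlice i σ := by
  simp [Instrument.onAlice, Matrix.mul_add, Matrix.add_mul, Finset.sum_add_distrib]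

theorem Instrument.onBob_add (E : Instrument b b' m) (i : Fin m) (ρ σ : BiOp a b) :
    E.onBob i (ρ + σ) = E.onBob i ρ + E.onBob i σ := by
  simp [Instrument.onBob, Matrix.mul_add, Matrix.add_mul, Finset.sum_add_distrib]

theorem Instrument.onAlice_smul (E : Instrument a a' m) (i : Fin m) (c : ℝ) (ρ : BiOp a b) :
    E.onAlice i (c • ρ) = c • E.onAlice i ρ := by
  simp [Instrument.onAlice, Finset.smul_sum]

theorem Instrument.onBob_smul (E : Instrument b b' m) (i : Fin m) (c : ℝ) (ρ : BiOp a b) :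
    E.onBob i (c • ρ) = c • E.onBob i ρ := by
  simp [Instrument.onBob, Finset.smul_sum]

theorem LOCC.branch_add (j : Fin r) (P : LOCC M r a b) (ρ σ : BiOp a b) :
    P.branch j (ρ + σ) = P.branch j ρ + P.branch j σ := by
  induction P with
  | fail a b => simp [LOCC.branch]
  | output j' => simp only [LOCC.branch]; split_ifs <;> simp
  | alice a' m E next ih =>
    simp [LOCC.branch, Instrument.onAlice_add, ih, Finset.sum_add_distrib]
  | bob b' m E next ih =>
    simp [LOCC.branch, Instrument.onBob_add, ih, Finset.sum_add_distrib]

theorem LOCC.branch_smul (j : Fin r) (P : LOCC M r a b) (c : ℝ) (ρ : BiOp a b) :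
    P.branch j (c • ρ) = c • P.branch j ρ := by
  induction P with
  | fail a b => simp [LOCC.branch]
  | output j' => simp only [LOCC.branch]; split_ifs <;> simp
  | alice a' m E next ih =>
    simp [LOCC.branch, Instrument.onAlice_smul, ih, Finset.smul_sum]
  | bob b' m E next ih =>
    simp [LOCC.branch, Instrument.onBob_smul, ih, Finset.smul_sum]

theorem fidelity_add {T : ℕ} (ρ σ : BiOp T T) : fidelity (ρ + σ) = fidelity ρ + fidelity σ := by
  simp [fidelity, Matrix.add_mulVec]

theorem fidelity_smul {T : ℕ} (c : ℝ) (ρ : BiOp T T) : fidelity (c • ρ) = c * fidelity ρ := by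
  simp [fidelity, Matrix.smul_mulVec]

/-- The fidelity as a linear functional. -/
noncomputable def fidelityLin (T : ℕ) : BiOp T T →ₗ[ℝ] ℝ where
  toFun := fidelity
  map_add' := fidelity_add
  map_smul' := fidelity_smul

theorem fidelity_sum {T : ℕ} {ι : Type*} (s : Finset ι) (f : ι → BiOp T T) :
    fidelity (∑ i ∈ s, f i) = ∑ i ∈ s, fidelity (f i) :=
  map_sum (fidelityLin T) f s

/-- The fidelity of the unnormalised output, all records being mixed, as a linear functional of the
input. -/
noncomputable def LOCC.outFidelity (P : LOCC M r a b) : BiOp a b →ₗ[ℝ] ℝ where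
  toFun ρ := ∑ j, fidelity (P.branch j ρ)
  map_add' ρ σ := by simp [LOCC.branch_add, fidelity_add, Finset.sum_add_distrib]
  map_smul' c ρ := by simp [LOCC.branch_smul, fidelity_smul, Finset.mul_sum]

theorem LOCC.outFidelity_apply (P : LOCC M r a b) (ρ : BiOp a b) :
    P.outFidelity ρ = ∑ j, fidelity (P.branch j ρ) := rfl

theorem LOCC.outFidelity_fail (ρ : BiOp a b) :
    (LOCC.fail a b : LOCC M r a b).outFidelity ρ = 0 := by
  simp [LOCC.outFidelity_apply, LOCC.branch, fidelity]

theorem LOCC.outFidelity_output (j : Fin r) (ρ : BiOp M M) :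
    (LOCC.output j : LOCC M r M M).outFidelity ρ = fidelity ρ := by
  rw [LOCC.outFidelity_apply, Finset.sum_eq_single j]
  · simp [LOCC.branch]
  · intro i _ hi
    simp [LOCC.branch, hi.symm, fidelity]
  · simp

theorem LOCC.outFidelity_alice (E : Instrument a a' m) (next : Fin m → LOCC M r a' b)
    (ρ : BiOp a b) :
    (LOCC.alice a' m E next).outFidelity ρ = ∑ i, (next i).outFidelity (E.onAlice i ρ) := by
  simp only [LOCC.outFidelity_apply, LOCC.branch, fidelity_sum]
  exact Finset.sum_comm

theorem LOCC.outFidelity_bob (E : Instrument b b' m) (next : Fin m → LOCC M r a b')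
    (ρ : BiOp a b) :
    (LOCC.bob b' m E next).outFidelity ρ = ∑ i, (next i).outFidelity (E.onBob i ρ) := by
  simp only [LOCC.outFidelity_apply, LOCC.branch, fidelity_sum]
  exact Finset.sum_comm

end Linearity

/-! ### Conservation of probability and positivity -/

section TraceAndPositivity

theorem Instrument.sum_trace_onAlice (E : Instrument a a' m) (ρ : BiOp a b) :
    ∑ i, (E.onAlice i ρ).trace = ρ.trace := by
  have h : ∀ i k, ((E.kraus i k ⊗ₖ (1 : Matrix (Fin b) (Fin b) ℂ)) * ρ *
      (E.kraus i k ⊗ₖ (1 : Matrix (Fin b) (Fin b) ℂ))ᴴ).trace =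
      ((((E.kraus i k)ᴴ * E.kraus i k) ⊗ₖ (1 : Matrix (Fin b) (Fin b) ℂ)) * ρ).trace := by
    intro i k
    rw [Matrix.trace_mul_comm, ← Matrix.mul_assoc, Matrix.conjTranspose_kronecker,
      ← Matrix.mul_kronecker_mul]
    simp
  simp only [Instrument.onAlice, Matrix.trace_sum, h]
  simp only [← Matrix.trace_sum, ← Finset.sum_mul]
  have h2 : ∑ i, ∑ k, ((E.kraus i k)ᴴ * E.kraus i k) ⊗ₖ (1 : Matrix (Fin b) (Fin b) ℂ) = 1 := by
    rw [← Matrix.one_kronecker_one, ← E.complete]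
    ext x y
    simp [Matrix.sum_apply, Finset.sum_mul]
  rw [h2, one_mul]

theorem Instrument.sum_trace_onBob (E : Instrument b b' m) (ρ : BiOp a b) :
    ∑ i, (E.onBob i ρ).trace = ρ.trace := by
  have h : ∀ i k, (((1 : Matrix (Fin a) (Fin a) ℂ) ⊗ₖ E.kraus i k) * ρ *
      ((1 : Matrix (Fin a) (Fin a) ℂ) ⊗ₖ E.kraus i k)ᴴ).trace =
      (((1 : Matrix (Fin a) (Fin a) ℂ) ⊗ₖ ((E.kraus i k)ᴴ * E.kraus i k)) * ρ).trace := by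
    intro i k
    rw [Matrix.trace_mul_comm, ← Matrix.mul_assoc, Matrix.conjTranspose_kronecker,
      ← Matrix.mul_kronecker_mul]
    simp
  simp only [Instrument.onBob, Matrix.trace_sum, h]
  simp only [← Matrix.trace_sum, ← Finset.sum_mul]
  have h2 : ∑ i, ∑ k, (1 : Matrix (Fin a) (Fin a) ℂ) ⊗ₖ ((E.kraus i k)ᴴ * E.kraus i k) = 1 := by
    rw [← Matrix.one_kronecker_one, ← E.complete]
    ext x y
    simp [Matrix.sum_apply, Finset.mul_sum]
  rw [h2, one_mul]

theorem LOCC.failProb_add_sum_outProb (P : LOCC M r a b) (ρ : BiOp a b) :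
    P.failProb ρ + ∑ j, P.outProb ρ j = ρ.trace.re := by
  induction P with
  | fail a b => simp [LOCC.failProb, LOCC.outProb, LOCC.branch]
  | output j' =>
    simp only [LOCC.failProb, LOCC.outProb, LOCC.branch, zero_add]
    rw [Finset.sum_eq_single j'] <;> simp +contextual [eq_comm]
  | alice a' m E next ih =>
    rw [← E.sum_trace_onAlice ρ, Complex.re_sum, ← Finset.sum_congr rfl fun i _ => ih i _,
      Finset.sum_add_distrib, Finset.sum_comm (γ := Fin m)]
    simp [LOCC.failProb, LOCC.outProb, LOCC.branch, Matrix.trace_sum]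
  | bob b' m E next ih =>
    rw [← E.sum_trace_onBob ρ, Complex.re_sum, ← Finset.sum_congr rfl fun i _ => ih i _,
      Finset.sum_add_distrib, Finset.sum_comm (γ := Fin m)]
    simp [LOCC.failProb, LOCC.outProb, LOCC.branch, Matrix.trace_sum]

theorem LOCC.posSemidef_branch (j : Fin r) (P : LOCC M r a b) {ρ : BiOp a b}
    (hρ : ρ.PosSemidef) : (P.branch j ρ).PosSemidef := by
  induction P with
  | fail a b => exact Matrix.PosSemidef.zero
  | output j' =>
    simp only [LOCC.branch]
    split_ifs
    · exact hρ
    · exact Matrix.PosSemidef.zero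
  | alice a' m E next ih =>
    exact Matrix.posSemidef_sum _ fun i _ => ih i
      (Matrix.posSemidef_sum _ fun k _ => hρ.mul_mul_conjTranspose_same _)
  | bob b' m E next ih =>
    exact Matrix.posSemidef_sum _ fun i _ => ih i
      (Matrix.posSemidef_sum _ fun k _ => hρ.mul_mul_conjTranspose_same _)

theorem fidelity_nonneg {T : ℕ} {ρ : BiOp T T} (hρ : ρ.PosSemidef) : 0 ≤ fidelity ρ :=
  (Complex.le_def.1 (hρ.dotProduct_mulVec_nonneg (maxEnt T))).1

end TraceAndPositivity

/-! ### Pure states: Schmidt rank bounds the reachable fidelity -/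

section PureStates

/-- The rank one operator of the vector in `ℂ^a ⊗ ℂ^b` with coefficient matrix `X`; the Schmidt rank
of this vector is the rank of `X`. -/
def pureOp (X : Matrix (Fin a) (Fin b) ℂ) : BiOp a b :=
  Matrix.vecMulVec (fun p => X p.1 p.2) (star fun p : Fin a × Fin b => X p.1 p.2)

theorem posSemidef_pureOp (X : Matrix (Fin a) (Fin b) ℂ) : (pureOp X).PosSemidef :=
  Matrix.posSemidef_vecMulVec_self_star _

theorem mul_pureOp_mul_conjTranspose (A : Matrix (Fin a' × Fin b') (Fin a × Fin b) ℂ)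
    (X : Matrix (Fin a) (Fin b) ℂ) (Y : Matrix (Fin a') (Fin b') ℂ)
    (h : A *ᵥ (fun p => X p.1 p.2) = fun p => Y p.1 p.2) : A * pureOp X * Aᴴ = pureOp Y := by
  rw [pureOp, pureOp, Matrix.mul_vecMulVec, Matrix.vecMulVec_mul, ← Matrix.star_mulVec, h]

theorem Instrument.onAlice_pureOp (E : Instrument a a' m) (i : Fin m)
    (X : Matrix (Fin a) (Fin b) ℂ) :
    E.onAlice i (pureOp X) = ∑ k, pureOp (E.kraus i k * X) := by
  refine Finset.sum_congr rfl fun k _ => mul_pureOp_mul_conjTranspose _ _ _ ?_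
  ext p
  simp [Matrix.mulVec, dotProduct, Fintype.sum_prod_type, Matrix.mul_apply, Matrix.one_apply]

theorem Instrument.onBob_pureOp (E : Instrument b b' m) (i : Fin m)
    (X : Matrix (Fin a) (Fin b) ℂ) :
    E.onBob i (pureOp X) = ∑ k, pureOp (X * (E.kraus i k)ᵀ) := by
  refine Finset.sum_congr rfl fun k _ => mul_pureOp_mul_conjTranspose _ _ _ ?_
  ext p
  simp [Matrix.mulVec, dotProduct, Fintype.sum_prod_type, Matrix.mul_apply, Matrix.one_apply,
    mul_comm]

theorem trace_pureOp_re (X : Matrix (Fin a) (Fin b) ℂ) :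
    (pureOp X).trace.re = ∑ j, ∑ i, ‖X i j‖ ^ 2 := by
  rw [Finset.sum_comm]
  simp only [pureOp, Matrix.trace_vecMulVec, dotProduct, Fintype.sum_prod_type, Pi.star_apply,
    Complex.re_sum]
  refine Finset.sum_congr rfl fun i _ => Finset.sum_congr rfl fun j _ => ?_
  rw [Complex.star_def, Complex.mul_conj, Complex.ofReal_re, Complex.normSq_eq_norm_sq]

theorem fidelity_eq_sum {T : ℕ} (ρ : BiOp T T) :
    fidelity ρ = (1 / T : ℝ) * ∑ i, ∑ j, (ρ (i, i) (j, j)).re := by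
  have h : (star (maxEnt T) ⬝ᵥ (ρ *ᵥ maxEnt T)) =
      ((1 / T : ℝ) : ℂ) * ∑ i, ∑ j, ρ (i, i) (j, j) := by
    have hT : ((1 / T : ℝ) : ℂ) = ((1 / Real.sqrt T : ℝ) : ℂ) * ((1 / Real.sqrt T : ℝ) : ℂ) := by
      rw [← Complex.ofReal_mul, div_mul_div_comm, one_mul, Real.mul_self_sqrt (Nat.cast_nonneg T)]
    have hsum : ∀ f : Fin T × Fin T → ℂ,
        ∑ p, maxEnt T p * f p = ((1 / Real.sqrt T : ℝ) : ℂ) * ∑ i, f (i, i) := fun f => by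
      simp only [maxEnt, Fintype.sum_prod_type, ite_mul, zero_mul, Finset.sum_ite_eq,
        Finset.mem_univ, if_true, Finset.mul_sum]
    have hstar : star (maxEnt T) = maxEnt T := by
      ext p
      simp only [maxEnt, Pi.star_apply]
      split_ifs <;> simp
    simp only [hT, hstar, dotProduct, Matrix.mulVec, hsum, mul_comm (ρ _ _)]
    rw [mul_assoc]
    simp only [Finset.mul_sum]
  rw [fidelity, h, Complex.re_ofReal_mul]
  simp

theorem fidelity_pureOp (X : Matrix (Fin M) (Fin M) ℂ) :
    fidelity (pureOp X) = (1 / M : ℝ) * ‖X.trace‖ ^ 2 := by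
  rw [fidelity_eq_sum, ← Complex.normSq_eq_norm_sq, ← Complex.ofReal_re (Complex.normSq _),
    ← Complex.mul_conj]
  simp [pureOp, Matrix.vecMulVec_apply, Matrix.trace, Finset.sum_mul_sum]

/-- Expand each column in an orthonormal basis `e` of the column space, which has `X.rank` elements.
The trace becomes a sum over pairs (column, basis vector) of coefficient times entry of `e`.
Cauchy–Schwarz over the pairs separates the squared norm of `X` from the total squared norm of `e`,
which is the rank. -/
theorem norm_trace_sq_le_rank_mul (X : Matrix (Fin M) (Fin M) ℂ) :
    ‖X.trace‖ ^ 2 ≤ X.rank * ∑ j, ∑ i, ‖X i j‖ ^ 2 := by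
  let col : Fin M → EuclideanSpace ℂ (Fin M) := fun j => WithLp.toLp 2 fun i => X i j
  let S : Submodule ℂ (EuclideanSpace ℂ (Fin M)) := Submodule.span ℂ (Set.range col)
  have hS : Module.finrank ℂ S = X.rank := by
    rw [Matrix.rank_eq_finrank_span_cols]
    have : S = (Submodule.span ℂ (Set.range X.col)).map
        (WithLp.linearEquiv 2 ℂ (Fin M → ℂ)).symm.toLinearMap := by
      rw [Submodule.map_span, ← Set.range_comp]
      rfl
    rw [this]
    exact LinearEquiv.finrank_map_eq _ _
  let e := stdOrthonormalBasis ℂ S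
  have hcol : ∀ j, col j ∈ S := fun j => Submodule.subset_span ⟨j, rfl⟩
  let w : Fin M → Fin (Module.finrank ℂ S) → ℂ := fun j i => e.repr ⟨col j, hcol j⟩ i
  have hX : ∀ i j, X i j = ∑ k, w j k * (e k : EuclideanSpace ℂ (Fin M)) i := by
    intro i j
    have h := congrArg (fun v : S => (v : EuclideanSpace ℂ (Fin M)) i)
      (e.sum_repr ⟨col j, hcol j⟩)
    simpa [w, col] using h.symm
  have hw : ∀ j, ∑ k, ‖w j k‖ ^ 2 = ∑ i, ‖X i j‖ ^ 2 := by
    intro j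
    rw [← EuclideanSpace.norm_sq_eq, LinearIsometryEquiv.norm_map]
    exact EuclideanSpace.norm_sq_eq (col j)
  have he : ∑ j, ∑ k, ‖(e k : EuclideanSpace ℂ (Fin M)) j‖ ^ 2 = (X.rank : ℝ) := by
    rw [Finset.sum_comm]
    have h1 : ∀ k, ∑ j, ‖(e k : EuclideanSpace ℂ (Fin M)) j‖ ^ 2 = 1 := fun k => by
      rw [← EuclideanSpace.norm_sq_eq, ← Submodule.coe_norm, e.norm_eq_one, one_pow]
    simp only [h1, ← hS]
    simp
  have hnorm : ‖X.trace‖ ≤ ∑ p : Fin M × Fin (Module.finrank ℂ S),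
      ‖w p.1 p.2‖ * ‖(e p.2 : EuclideanSpace ℂ (Fin M)) p.1‖ := by
    rw [Fintype.sum_prod_type]
    refine (norm_sum_le _ _).trans (Finset.sum_le_sum fun j _ => ?_)
    rw [Matrix.diag_apply, hX]
    exact (norm_sum_le _ _).trans_eq (Finset.sum_congr rfl fun k _ => norm_mul _ _)
  calc ‖X.trace‖ ^ 2 ≤ _ := pow_le_pow_left₀ (norm_nonneg _) hnorm 2
    _ ≤ _ := Finset.sum_mul_sq_le_sq_mul_sq _ _ _
    _ = _ := by
      rw [Fintype.sum_prod_type, Fintype.sum_prod_type]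
      simp only [hw, he]
      ring

/-- Induction over the protocol: each Kraus operator keeps the state pure and its rank at most `s`,
while the traces of the branches add up to the original trace. At an output the rank is also at most
`M`, whence the minimum. -/
theorem LOCC.outFidelity_pureOp_le (P : LOCC M r a b) (X : Matrix (Fin a) (Fin b) ℂ) {s : ℕ}
    (hX : X.rank ≤ s) :
    P.outFidelity (pureOp X) ≤ (min s M : ℕ) / M * (pureOp X).trace.re := by
  have hc : (0 : ℝ) ≤ (min s M : ℕ) / M := by positivity
  induction P with
  | fail a b =>
    rw [LOCC.outFidelity_fail, trace_pureOp_re]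
    positivity
  | output j =>
    rw [LOCC.outFidelity_output, fidelity_pureOp, trace_pureOp_re, one_div_mul_eq_div,
      div_mul_eq_mul_div]
    gcongr
    refine (norm_trace_sq_le_rank_mul X).trans ?_
    gcongr
    exact le_min hX (X.rank_le_width)
  | alice a' m E next ih =>
    rw [LOCC.outFidelity_alice, ← E.sum_trace_onAlice, Complex.re_sum, Finset.mul_sum]
    refine Finset.sum_le_sum fun i _ => ?_
    rw [E.onAlice_pureOp, map_sum, Matrix.trace_sum, Complex.re_sum, Finset.mul_sum]
    exact Finset.sum_le_sum fun k _ => ih i _ ((Matrix.rank_mul_le_right _ _).trans hX)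
  | bob b' m E next ih =>
    rw [LOCC.outFidelity_bob, ← E.sum_trace_onBob, Complex.re_sum, Finset.mul_sum]
    refine Finset.sum_le_sum fun i _ => ?_
    rw [E.onBob_pureOp, map_sum, Matrix.trace_sum, Complex.re_sum, Finset.mul_sum]
    exact Finset.sum_le_sum fun k _ => ih i _ ((Matrix.rank_mul_le_left _ _).trans hX)

end PureStates

end Basic


/-! ### Tensoring with the auxiliary state Ψ_K -/

section Auxiliary

variable {a b : ℕ}

/-- The state `ρ ⊗ |Ψ_K⟩⟨Ψ_K|` for local dimensions that may differ. -/
noncomputable def tensorAux (K : ℕ) (ρ : BiOp a b) : BiOp (a * K) (b * K) :=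
  (ρ ⊗ₖ maxEntState K).submatrix
    (fun p => ((p.1.divNat, p.2.divNat), (p.1.modNat, p.2.modNat)))
    (fun p => ((p.1.divNat, p.2.divNat), (p.1.modNat, p.2.modNat)))

theorem withAux_eq_tensorAux {N : ℕ} (K : ℕ) (ρ : BiOp N N) : withAux K ρ = tensorAux K ρ := rfl

theorem tensorAux_apply (K : ℕ) (ρ : BiOp a b) (p q : Fin (a * K) × Fin (b * K)) :
    tensorAux K ρ p q = ρ (p.1.divNat, p.2.divNat) (q.1.divNat, q.2.divNat) *
      maxEntState K (p.1.modNat, p.2.modNat) (q.1.modNat, q.2.modNat) := rfl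

theorem tensorAux_add (K : ℕ) (ρ σ : BiOp a b) :
    tensorAux K (ρ + σ) = tensorAux K ρ + tensorAux K σ := by
  ext p q
  simp [tensorAux_apply, add_mul]

theorem tensorAux_smul (K : ℕ) (c : ℝ) (ρ : BiOp a b) :
    tensorAux K (c • ρ) = c • tensorAux K ρ := by
  ext p q
  simp [tensorAux_apply, mul_assoc]

theorem tensorAux_sum {ι : Type*} (K : ℕ) (s : Finset ι) (f : ι → BiOp a b) :
    tensorAux K (∑ i ∈ s, f i) = ∑ i ∈ s, tensorAux K (f i) := by
  ext p q
  simp [tensorAux_apply, Matrix.sum_apply, Finset.sum_mul]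

theorem sum_fin_mul {α : Type*} [AddCommMonoid α] {n K : ℕ} (f : Fin (n * K) → α) :
    ∑ i, f i = ∑ x : Fin n, ∑ k : Fin K, f (finProdFinEquiv (x, k)) := by
  rw [← Fintype.sum_prod_type', ← finProdFinEquiv.sum_comp]

theorem divNat_finProdFinEquiv {n K : ℕ} (x : Fin n) (k : Fin K) :
    (finProdFinEquiv (x, k)).divNat = x :=
  congrArg Prod.fst (finProdFinEquiv.symm_apply_apply (x, k))

theorem modNat_finProdFinEquiv {n K : ℕ} (x : Fin n) (k : Fin K) :
    (finProdFinEquiv (x, k)).modNat = k :=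
  congrArg Prod.snd (finProdFinEquiv.symm_apply_apply (x, k))

theorem maxEntState_apply {T : ℕ} (p q : Fin T × Fin T) :
    maxEntState T p q = if p.1 = p.2 ∧ q.1 = q.2 then ((1 / T : ℝ) : ℂ) else 0 := by
  have hT : ((1 / T : ℝ) : ℂ) = ((1 / Real.sqrt T : ℝ) : ℂ) * ((1 / Real.sqrt T : ℝ) : ℂ) := by
    rw [← Complex.ofReal_mul, div_mul_div_comm, one_mul, Real.mul_self_sqrt (Nat.cast_nonneg T)]
  simp only [maxEntState, Matrix.vecMulVec_apply, maxEnt, Pi.star_apply, hT, ite_and]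
  split_ifs <;> simp

theorem trace_maxEntState {T : ℕ} (hT : 1 ≤ T) : (maxEntState T).trace = 1 := by
  have : (T : ℂ) ≠ 0 := by exact_mod_cast (by omega : T ≠ 0)
  simp [Matrix.trace, Fintype.sum_prod_type, maxEntState_apply, this]

theorem fidelity_maxEntState {T : ℕ} (hT : 1 ≤ T) : fidelity (maxEntState T) = 1 := by
  have : (T : ℝ) ≠ 0 := by exact_mod_cast (by omega : T ≠ 0)
  have h : ((T : ℂ)⁻¹).re = (T : ℝ)⁻¹ := by
    rw [← Complex.ofReal_natCast, ← Complex.ofReal_inv, Complex.ofReal_re]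
  rw [fidelity_eq_sum]
  simp [maxEntState_apply, h]
  field_simp

theorem trace_tensorAux {K : ℕ} (hK : 1 ≤ K) (ρ : BiOp a b) :
    (tensorAux K ρ).trace = ρ.trace := by
  have : (K : ℂ) ≠ 0 := by exact_mod_cast (by omega : K ≠ 0)
  simp only [Matrix.trace, Matrix.diag_apply, Fintype.sum_prod_type, sum_fin_mul,
    tensorAux_apply, divNat_finProdFinEquiv, modNat_finProdFinEquiv, maxEntState_apply]
  simp [← Finset.mul_sum, ← Finset.sum_mul]
  field_simp

theorem fidelity_tensorAux {K : ℕ} (hK : 1 ≤ K) (ρ : BiOp a a) :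
    fidelity (tensorAux K ρ) = fidelity ρ := by
  have : (K : ℝ) ≠ 0 := by exact_mod_cast (by omega : K ≠ 0)
  have h : ∀ z : ℂ, (z * (K : ℂ)⁻¹).re = z.re * (K : ℝ)⁻¹ := fun z => by
    rw [← Complex.ofReal_natCast, ← Complex.ofReal_inv, Complex.re_mul_ofReal]
  simp only [fidelity_eq_sum, sum_fin_mul, tensorAux_apply, divNat_finProdFinEquiv,
    maxEntState_apply]
  simp [h, ← Finset.mul_sum, ← Finset.sum_mul]
  field_simp

/-- The coefficient matrix of the tensor product of a vector with `Ψ_K`. -/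
noncomputable def coeffAux (K : ℕ) (X : Matrix (Fin a) (Fin b) ℂ) :
    Matrix (Fin (a * K)) (Fin (b * K)) ℂ :=
  Matrix.of fun i j => X i.divNat j.divNat * maxEnt K (i.modNat, j.modNat)

theorem tensorAux_pureOp (K : ℕ) (X : Matrix (Fin a) (Fin b) ℂ) :
    tensorAux K (pureOp X) = pureOp (coeffAux K X) := by
  ext p q
  simp [tensorAux_apply, pureOp, maxEntState, Matrix.vecMulVec_apply, coeffAux]
  ring

/-- For a product vector the coefficient matrix factors through ℂ^K. -/
theorem rank_coeffAux_vecMulVec_le (K : ℕ) (u : Fin a → ℂ) (v : Fin b → ℂ) :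
    (coeffAux K (Matrix.vecMulVec u v)).rank ≤ K := by
  have h : coeffAux K (Matrix.vecMulVec u v) =
      (Matrix.of fun (i : Fin (a * K)) (k : Fin K) => if i.modNat = k then u i.divNat else 0) *
      (Matrix.of fun (k : Fin K) (j : Fin (b * K)) => v j.divNat * maxEnt K (k, j.modNat)) := by
    ext i j
    simp [coeffAux, Matrix.mul_apply, Matrix.vecMulVec_apply, mul_assoc]
  rw [h]
  exact (Matrix.rank_mul_le_left _ _).trans (Matrix.rank_le_width _)

theorem posSemidef_maxEntState (T : ℕ) : (maxEntState T).PosSemidef :=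
  Matrix.posSemidef_vecMulVec_self_star _

theorem maxEntState_eq_pureOp (T : ℕ) :
    maxEntState T = pureOp (Matrix.of fun i j => maxEnt T (i, j)) := rfl

theorem posSemidef_tensorAux (K : ℕ) {ρ : BiOp a b} (hρ : ρ.PosSemidef) :
    (tensorAux K ρ).PosSemidef :=
  (hρ.kronecker (posSemidef_maxEntState K)).submatrix _

end Auxiliary

/-! ### Part (a): the lower bound on δ -/

section LowerBound

variable {N K M : ℕ}

/-- Records of fidelity at least 1 - δ carry total probability 1, and the remaining ones contribute
nonnegatively to the expectation. -/
theorem GEPP.AbsolutelySuccessful.one_sub_le_outFidelity {P : GEPP N K M} {ε δ : ℝ}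
    (hP : P.AbsolutelySuccessful ε δ) {ρ : BiOp N N} (hρ : IsState ρ) (hF : 1 - ε ≤ fidelity ρ) :
    1 - δ ≤ P.locc.outFidelity (withAux K ρ) := by
  have hpos := fun j => P.locc.posSemidef_branch j (posSemidef_tensorAux K hρ.1)
  have h1 : 1 - δ = (1 - δ) * P.probFidelityGE ρ (1 - δ) := by rw [(hP ρ hρ hF).2, mul_one]
  rw [h1, LOCC.outFidelity_apply, GEPP.probFidelityGE, Finset.mul_sum]
  refine Finset.sum_le_sum fun j _ => ?_
  have hp : 0 ≤ P.locc.outProb (withAux K ρ) j := (Complex.le_def.1 (hpos j).trace_nonneg).1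
  have hf : 0 ≤ fidelity (P.locc.branch j (withAux K ρ)) := fidelity_nonneg (hpos j)
  split_ifs with h
  · refine (mul_le_mul_of_nonneg_right h hp).trans ?_
    rw [LOCC.outState, fidelity_smul]
    -- A record of probability zero has the junk normalisation `0⁻¹ = 0`; there the left side
    -- vanishes.
    rcases eq_or_ne (P.locc.outProb (withAux K ρ) j) 0 with h0 | h0
    · simpa [h0] using hf
    · rw [mul_comm, mul_inv_cancel_left₀ h0]
  · simpa using hf

theorem LOCC.outFidelity_withAux_pureOp_le {r : ℕ} (hK : 1 ≤ K) (P : LOCC M r (N * K) (N * K))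
    (X : Matrix (Fin N) (Fin N) ℂ) {s : ℕ} (hX : (coeffAux K X).rank ≤ s) :
    P.outFidelity (withAux K (pureOp X)) ≤ (min s M : ℕ) / M * (pureOp X).trace.re := by
  rw [withAux_eq_tensorAux, ← trace_tensorAux hK, tensorAux_pureOp]
  exact P.outFidelity_pureOp_le _ hX

theorem GEPP.AbsolutelySuccessful.le_delta (hN : 2 ≤ N) (hK : 1 ≤ K) (hM : 1 ≤ M) {ε δ : ℝ}
    (hε : 0 ≤ ε) (hε' : ε ≤ 1 - 1 / (N : ℝ)) {P : GEPP N K M}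
    (hP : P.AbsolutelySuccessful ε δ) :
    ((M : ℝ) - K) / M * ((N : ℝ) / ((N : ℝ) - 1)) * ε ≤ δ := by
  have hN2 : (2 : ℝ) ≤ N := by exact_mod_cast hN
  have hN1 : (0 : ℝ) < (N : ℝ) - 1 := by linarith
  have hN0 : (0 : ℝ) < N := by linarith
  have hM0 : (0 : ℝ) < M := by exact_mod_cast hM
  -- The weight for which (1 - t) + t/N = 1 - ε; the hypothesis ε ≤ 1 - 1/N says exactly that t ≤ 1.
  set t : ℝ := N / (N - 1) * ε with ht
  have ht0 : 0 ≤ t := by positivity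
  have ht1 : t ≤ 1 := by
    rw [ht, div_mul_eq_mul_div, div_le_one hN1]
    calc (N : ℝ) * ε ≤ N * (1 - 1 / N) := by gcongr
      _ = N - 1 := by field_simp
  let u : Fin N → ℂ := Pi.single ⟨0, by omega⟩ 1
  let X : Matrix (Fin N) (Fin N) ℂ := Matrix.vecMulVec u u
  have htX : (pureOp X).trace.re = 1 := by
    simp [trace_pureOp_re, X, u, Matrix.vecMulVec_apply, Pi.single_apply, apply_ite, ite_pow]
  have htX' : (pureOp X).trace = 1 := by
    have h := (posSemidef_pureOp X).trace_nonneg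
    exact Complex.ext htX (Complex.le_def.1 h).2.symm
  have hfX : fidelity (pureOp X) = 1 / N := by
    have : X.trace = 1 := by simp [X, u, Matrix.trace_vecMulVec]
    simp [fidelity_pureOp, this]
  let ρ : BiOp N N := (1 - t) • maxEntState N + t • pureOp X
  have hρ : IsState ρ := by
    refine ⟨((posSemidef_maxEntState N).smul (by linarith)).add ((posSemidef_pureOp X).smul ht0),
      ?_⟩
    simp [ρ, Matrix.trace_add, Matrix.trace_smul, trace_maxEntState (show 1 ≤ N by omega), htX']
  have hF : 1 - ε ≤ fidelity ρ := by
    rw [fidelity_add, fidelity_smul, fidelity_smul, fidelity_maxEntState (by omega), hfX, ht]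
    apply le_of_eq
    field_simp
    ring
  have h1 := hP.one_sub_le_outFidelity hρ hF
  -- For the Ψ_N component the trivial bound 1 suffices; all the loss comes from the product
  -- component in `h3`.
  have h2 : P.locc.outFidelity (withAux K (maxEntState N)) ≤ 1 := by
    rw [maxEntState_eq_pureOp]
    refine (P.locc.outFidelity_withAux_pureOp_le hK _ le_rfl).trans ?_
    rw [← maxEntState_eq_pureOp, trace_maxEntState (by omega), Complex.one_re, mul_one,
      div_le_one hM0]
    exact_mod_cast min_le_right _ _
  have h3 : P.locc.outFidelity (withAux K (pureOp X)) ≤ K / M := by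
    refine (P.locc.outFidelity_withAux_pureOp_le hK _ (rank_coeffAux_vecMulVec_le K u u)).trans ?_
    rw [htX, mul_one]
    gcongr
    exact min_le_left _ _
  rw [withAux_eq_tensorAux, tensorAux_add, tensorAux_smul, tensorAux_smul, map_add, map_smul,
    map_smul, smul_eq_mul, smul_eq_mul] at h1
  have h4 : 1 - δ ≤ (1 - t) * 1 + t * (K / M) :=
    h1.trans (add_le_add (mul_le_mul_of_nonneg_left h2 (by linarith))
      (mul_le_mul_of_nonneg_left h3 ht0))
  have h5 : ((M : ℝ) - K) / M * (N / (N - 1)) * ε = t - t * (K / M) := by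
    rw [ht]
    field_simp
  linarith

end LowerBound


/-! ### Running a protocol beside an untouched Ψ_K -/

section Lift

variable {a a' b b' d d' d'' m L r : ℕ}

/-- The operator `A ⊗ 1` on `ℂ^d ⊗ ℂ^K = ℂ^(d * K)`. -/
def tensorOne (K : ℕ) (A : Matrix (Fin d') (Fin d) ℂ) : Matrix (Fin (d' * K)) (Fin (d * K)) ℂ :=
  (A ⊗ₖ (1 : Matrix (Fin K) (Fin K) ℂ)).submatrix finProdFinEquiv.symm finProdFinEquiv.symm

theorem conjTranspose_tensorOne_mul_self (K : ℕ) (A : Matrix (Fin d') (Fin d) ℂ) :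
    (tensorOne K A)ᴴ * tensorOne K A = tensorOne K (Aᴴ * A) := by
  rw [tensorOne, Matrix.conjTranspose_submatrix, Matrix.submatrix_mul_equiv,
    Matrix.conjTranspose_kronecker, ← Matrix.mul_kronecker_mul]
  simp [tensorOne]

theorem tensorOne_one (K : ℕ) : tensorOne K (1 : Matrix (Fin d) (Fin d) ℂ) = 1 := by
  rw [tensorOne, Matrix.one_kronecker_one, Matrix.submatrix_one_equiv]

theorem tensorOne_sum {ι : Type*} (K : ℕ) (s : Finset ι) (f : ι → Matrix (Fin d') (Fin d) ℂ) :
    tensorOne K (∑ i ∈ s, f i) = ∑ i ∈ s, tensorOne K (f i) := by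
  ext p q
  simp [tensorOne, Matrix.sum_apply, Finset.sum_mul]

/-- The instrument acting as `E` on the first factor of `ℂ^d ⊗ ℂ^K`. -/
def Instrument.lift (K : ℕ) (E : Instrument d d' m) : Instrument (d * K) (d' * K) m where
  numKraus := E.numKraus
  kraus i k := tensorOne K (E.kraus i k)
  complete := by
    simp only [conjTranspose_tensorOne_mul_self, ← tensorOne_sum, E.complete, tensorOne_one]

/-- The regrouping of `(ℂ^a ⊗ ℂ^K) ⊗ (ℂ^b ⊗ ℂ^K)` into `(ℂ^a ⊗ ℂ^b) ⊗ (ℂ^K ⊗ ℂ^K)`. -/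
def regroup (a b K : ℕ) : Fin (a * K) × Fin (b * K) ≃ (Fin a × Fin b) × (Fin K × Fin K) :=
  (Equiv.prodCongr finProdFinEquiv.symm finProdFinEquiv.symm).trans
    (Equiv.prodProdProdComm _ _ _ _)

theorem tensorAux_eq_submatrix (K : ℕ) (ρ : BiOp a b) :
    tensorAux K ρ = (ρ ⊗ₖ maxEntState K).submatrix (regroup a b K) (regroup a b K) := rfl

theorem tensorAux_conj (K : ℕ) (A : Matrix (Fin a') (Fin a) ℂ) (B : Matrix (Fin b') (Fin b) ℂ)
    (ρ : BiOp a b) :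
    (tensorOne K A ⊗ₖ tensorOne K B) * tensorAux K ρ * (tensorOne K A ⊗ₖ tensorOne K B)ᴴ =
      tensorAux K ((A ⊗ₖ B) * ρ * (A ⊗ₖ B)ᴴ) := by
  have h : tensorOne K A ⊗ₖ tensorOne K B =
      ((A ⊗ₖ B) ⊗ₖ (1 : Matrix (Fin K × Fin K) (Fin K × Fin K) ℂ)).submatrix
        (regroup a' b' K) (regroup a b K) := by
    rw [← Matrix.one_kronecker_one]
    ext p q
    simp only [tensorOne, regroup, Matrix.kroneckerMap_apply, Matrix.submatrix_apply,
      Equiv.trans_apply, Equiv.prodCongr_apply, Prod.map, Equiv.prodProdProdComm_apply]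
    ring
  rw [h, tensorAux_eq_submatrix, tensorAux_eq_submatrix, Matrix.conjTranspose_submatrix,
    Matrix.submatrix_mul_equiv, Matrix.submatrix_mul_equiv, Matrix.conjTranspose_kronecker,
    ← Matrix.mul_kronecker_mul, ← Matrix.mul_kronecker_mul]
  simp

theorem Instrument.lift_onAlice (K : ℕ) (E : Instrument a a' m) (i : Fin m) (ρ : BiOp a b) :
    (E.lift K).onAlice i (tensorAux K ρ) = tensorAux K (E.onAlice i ρ) := by
  rw [Instrument.onAlice, Instrument.onAlice, tensorAux_sum]
  refine Finset.sum_congr rfl fun k _ => ?_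
  rw [← tensorAux_conj, tensorOne_one]
  rfl

theorem Instrument.lift_onBob (K : ℕ) (E : Instrument b b' m) (i : Fin m) (ρ : BiOp a b) :
    (E.lift K).onBob i (tensorAux K ρ) = tensorAux K (E.onBob i ρ) := by
  rw [Instrument.onBob, Instrument.onBob, tensorAux_sum]
  refine Finset.sum_congr rfl fun k _ => ?_
  rw [← tensorAux_conj, tensorOne_one]
  rfl

/-- The protocol acting as `P` on the first factors and leaving the auxiliary state untouched. -/
def LOCC.lift (K : ℕ) : {a b : ℕ} → LOCC L r a b → LOCC (L * K) r (a * K) (b * K)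
  | _, _, fail a b => fail (a * K) (b * K)
  | _, _, output j => output j
  | _, _, alice a' m E next => alice (a' * K) m (E.lift K) fun i => (next i).lift K
  | _, _, bob b' m E next => bob (b' * K) m (E.lift K) fun i => (next i).lift K

theorem LOCC.failProb_lift {K : ℕ} (hK : 1 ≤ K) (P : LOCC L r a b) (ρ : BiOp a b) :
    (P.lift K).failProb (tensorAux K ρ) = P.failProb ρ := by
  induction P with
  | fail a b => simp [LOCC.lift, LOCC.failProb, trace_tensorAux hK]
  | output j => simp [LOCC.lift, LOCC.failProb]
  | alice a' m E next ih => simp [LOCC.lift, LOCC.failProb, Instrument.lift_onAlice, ih]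
  | bob b' m E next ih => simp [LOCC.lift, LOCC.failProb, Instrument.lift_onBob, ih]

/-- Since Ψ_{LK} is Ψ_L ⊗ Ψ_K up to regrouping, the untouched factor has overlap 1 and drops out. -/
theorem LOCC.outFidelity_lift {K : ℕ} (hK : 1 ≤ K) (P : LOCC L r a b) (ρ : BiOp a b) :
    (P.lift K).outFidelity (tensorAux K ρ) = P.outFidelity ρ := by
  induction P with
  | fail a b => simp [LOCC.lift, LOCC.outFidelity_fail]
  | output j => simp [LOCC.lift, LOCC.outFidelity_output, fidelity_tensorAux hK]
  | alice a' m E next ih =>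
    simp [LOCC.lift, LOCC.outFidelity_alice, Instrument.lift_onAlice, ih]
  | bob b' m E next ih => simp [LOCC.lift, LOCC.outFidelity_bob, Instrument.lift_onBob, ih]

end Lift

/-! ### Instruments that select and relabel basis vectors -/

section Selection

variable {a a' b b' d d' L r : ℕ} {ι : Type*} [Fintype ι]

/-- The instrument with one Kraus operator `A i` for each outcome `i`. -/
noncomputable def Instrument.ofFamily (A : ι → Matrix (Fin d') (Fin d) ℂ)
    (h : ∑ i, (A i)ᴴ * A i = 1) : Instrument d d' (Fintype.card ι) where
  numKraus := 1
  kraus i _ := A ((Fintype.equivFin ι).symm i)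
  complete := by
    simp only [Finset.univ_unique, Finset.sum_const, Finset.card_singleton, one_smul]
    rw [← h]
    exact (Fintype.equivFin ι).symm.sum_comp fun i => (A i)ᴴ * A i

theorem Instrument.onAlice_ofFamily (A : ι → Matrix (Fin a') (Fin a) ℂ)
    (h : ∑ i, (A i)ᴴ * A i = 1) (i : Fin (Fintype.card ι)) (ρ : BiOp a b) :
    (Instrument.ofFamily A h).onAlice i ρ =
      (A ((Fintype.equivFin ι).symm i) ⊗ₖ (1 : Matrix (Fin b) (Fin b) ℂ)) * ρ *
        (A ((Fintype.equivFin ι).symm i) ⊗ₖ (1 : Matrix (Fin b) (Fin b) ℂ))ᴴ :=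
  Fin.sum_univ_one _

theorem Instrument.onBob_ofFamily (A : ι → Matrix (Fin b') (Fin b) ℂ)
    (h : ∑ i, (A i)ᴴ * A i = 1) (i : Fin (Fintype.card ι)) (ρ : BiOp a b) :
    (Instrument.ofFamily A h).onBob i ρ =
      ((1 : Matrix (Fin a) (Fin a) ℂ) ⊗ₖ A ((Fintype.equivFin ι).symm i)) * ρ *
        ((1 : Matrix (Fin a) (Fin a) ℂ) ⊗ₖ A ((Fintype.equivFin ι).symm i))ᴴ :=
  Fin.sum_univ_one _

/-- Alice applies the instrument with Kraus operators `A i`. -/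
noncomputable def LOCC.aliceFamily (A : ι → Matrix (Fin a') (Fin a) ℂ)
    (h : ∑ i, (A i)ᴴ * A i = 1) (next : ι → LOCC L r a' b) : LOCC L r a b :=
  .alice a' _ (.ofFamily A h) fun i => next ((Fintype.equivFin ι).symm i)

/-- Bob applies the instrument with Kraus operators `A i`. -/
noncomputable def LOCC.bobFamily (A : ι → Matrix (Fin b') (Fin b) ℂ)
    (h : ∑ i, (A i)ᴴ * A i = 1) (next : ι → LOCC L r a b') : LOCC L r a b :=
  .bob b' _ (.ofFamily A h) fun i => next ((Fintype.equivFin ι).symm i)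

theorem LOCC.outFidelity_aliceFamily (A : ι → Matrix (Fin a') (Fin a) ℂ)
    (h : ∑ i, (A i)ᴴ * A i = 1) (next : ι → LOCC L r a' b) (ρ : BiOp a b) :
    (LOCC.aliceFamily A h next).outFidelity ρ = ∑ i, (next i).outFidelity
      ((A i ⊗ₖ (1 : Matrix (Fin b) (Fin b) ℂ)) * ρ * (A i ⊗ₖ (1 : Matrix (Fin b) (Fin b) ℂ))ᴴ) := by
  rw [LOCC.aliceFamily, LOCC.outFidelity_alice, ← (Fintype.equivFin ι).symm.sum_comp]
  simp only [Instrument.onAlice_ofFamily]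

theorem LOCC.outFidelity_bobFamily (A : ι → Matrix (Fin b') (Fin b) ℂ)
    (h : ∑ i, (A i)ᴴ * A i = 1) (next : ι → LOCC L r a b') (ρ : BiOp a b) :
    (LOCC.bobFamily A h next).outFidelity ρ = ∑ i, (next i).outFidelity
      (((1 : Matrix (Fin a) (Fin a) ℂ) ⊗ₖ A i) * ρ * ((1 : Matrix (Fin a) (Fin a) ℂ) ⊗ₖ A i)ᴴ) := by
  rw [LOCC.bobFamily, LOCC.outFidelity_bob, ← (Fintype.equivFin ι).symm.sum_comp]
  simp only [Instrument.onBob_ofFamily]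

theorem LOCC.failProb_aliceFamily (A : ι → Matrix (Fin a') (Fin a) ℂ)
    (h : ∑ i, (A i)ᴴ * A i = 1) (next : ι → LOCC L r a' b)
    (hn : ∀ i σ, (next i).failProb σ = 0) (ρ : BiOp a b) :
    (LOCC.aliceFamily A h next).failProb ρ = 0 := by
  simp [LOCC.aliceFamily, LOCC.failProb, hn]

theorem LOCC.failProb_bobFamily (A : ι → Matrix (Fin b') (Fin b) ℂ)
    (h : ∑ i, (A i)ᴴ * A i = 1) (next : ι → LOCC L r a b')
    (hn : ∀ i σ, (next i).failProb σ = 0) (ρ : BiOp a b) :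
    (LOCC.bobFamily A h next).failProb ρ = 0 := by
  simp [LOCC.bobFamily, LOCC.failProb, hn]

/-- The operator `∑ l, α l |l⟩⟨f l|`. -/
def selector (f : Fin d' → Fin d) (α : Fin d' → ℝ) : Matrix (Fin d') (Fin d) ℂ :=
  Matrix.of fun l x => if x = f l then (α l : ℂ) else 0

theorem conjTranspose_selector_mul_self (f : Fin d' → Fin d) (α : Fin d' → ℝ) :
    (selector f α)ᴴ * selector f α =
      Matrix.diagonal fun x => ((∑ l, if x = f l then α l ^ 2 else 0 : ℝ) : ℂ) := by
  ext x y
  simp only [Matrix.mul_apply, selector, Matrix.conjTranspose_apply, Matrix.of_apply,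
    Matrix.diagonal_apply]
  rcases eq_or_ne x y with rfl | h
  · simp only [if_true, Complex.ofReal_sum]
    refine Finset.sum_congr rfl fun l _ => ?_
    split_ifs <;> simp [sq]
  · rw [if_neg h]
    refine Finset.sum_eq_zero fun l _ => ?_
    by_cases hx : x = f l
    · rw [if_neg fun hy : y = f l => h (hx.trans hy.symm), mul_zero]
    · simp [hx]

theorem alice_selector_apply (f : Fin a' → Fin a) (α : Fin a' → ℝ) (ρ : BiOp a b)
    (p q : Fin a' × Fin b) :
    ((selector f α ⊗ₖ (1 : Matrix (Fin b) (Fin b) ℂ)) * ρ *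
      (selector f α ⊗ₖ (1 : Matrix (Fin b) (Fin b) ℂ))ᴴ) p q =
      ((α p.1 * α q.1 : ℝ) : ℂ) * ρ (f p.1, p.2) (f q.1, q.2) := by
  simp [Matrix.mul_apply, selector, Fintype.sum_prod_type, Matrix.one_apply, apply_ite]
  ring

theorem bob_selector_apply (f : Fin b' → Fin b) (α : Fin b' → ℝ) (ρ : BiOp a b)
    (p q : Fin a × Fin b') :
    (((1 : Matrix (Fin a) (Fin a) ℂ) ⊗ₖ selector f α) * ρ *
      ((1 : Matrix (Fin a) (Fin a) ℂ) ⊗ₖ selector f α)ᴴ) p q =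
      ((α p.2 * α q.2 : ℝ) : ℂ) * ρ (p.1, f p.2) (q.1, f q.2) := by
  simp [Matrix.mul_apply, selector, Fintype.sum_prod_type, Matrix.one_apply, apply_ite]
  ring

end Selection

/-! ### Averaging over random partitions into equal blocks -/

section RandomBlocks

theorem sum_same_block_eq {N Q L : ℕ} (x : Fin N) :
    ∑ y, ∑ e : Fin N ≃ Fin Q × Fin L, (if (e x).1 = (e y).1 then (1 : ℝ) else 0) =
      Fintype.card (Fin N ≃ Fin Q × Fin L) * L := by
  rw [Finset.sum_comm]
  have h : ∀ e : Fin N ≃ Fin Q × Fin L,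
      ∑ y, (if (e x).1 = (e y).1 then (1 : ℝ) else 0) = L := fun e => by
    rw [e.sum_comp fun p => if (e x).1 = p.1 then (1 : ℝ) else 0, Fintype.sum_prod_type_right]
    simp
  simp [h]

/-- Two different elements fall into the same block of a random partition into blocks of size `L`
with probability `(L - 1) / (N - 1)`. -/
theorem sum_same_block {N Q L : ℕ} {x y : Fin N} (hxy : x ≠ y) :
    ((N : ℝ) - 1) * ∑ e : Fin N ≃ Fin Q × Fin L, (if (e x).1 = (e y).1 then (1 : ℝ) else 0) =
      Fintype.card (Fin N ≃ Fin Q × Fin L) * ((L : ℝ) - 1) := by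
  have h : ∀ z, x ≠ z →
      ∑ e : Fin N ≃ Fin Q × Fin L, (if (e x).1 = (e z).1 then (1 : ℝ) else 0) =
      ∑ e : Fin N ≃ Fin Q × Fin L, (if (e x).1 = (e y).1 then (1 : ℝ) else 0) := fun z hz => by
    -- By symmetry: precomposing with the transposition of `y` and `z` permutes the partitions and
    -- fixes `x`.
    refine Fintype.sum_equiv ((Equiv.swap y z).equivCongr (Equiv.refl _)) _ _ fun e => ?_
    simp [Equiv.swap_apply_of_ne_of_ne hxy hz]
  have h1 := sum_same_block_eq (Q := Q) (L := L) x
  -- Every partition puts `L` elements into the block of `x`. Removing `x` itself leaves `L - 1`,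
  -- shared equally among the other `N - 1` elements.
  rw [← Finset.add_sum_erase _ _ (Finset.mem_univ x),
    Finset.sum_congr rfl fun z hz => h z (Finset.ne_of_mem_erase hz).symm] at h1
  have hN : ((N - 1 : ℕ) : ℝ) = (N : ℝ) - 1 := by
    rw [Nat.cast_sub (by have := x.pos; omega), Nat.cast_one]
  simp only [if_true, Finset.sum_const, Finset.card_erase_of_mem (Finset.mem_univ x),
    Finset.card_univ, Fintype.card_fin, nsmul_eq_mul, mul_one, hN] at h1
  linarith

/-- The fidelity-like functional of a family of random blocks evaluates as if every pair of different
elements fell into the same block with probability `(L - 1) / (N - 1)`. -/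
theorem sum_blocks {N Q L : ℕ} (hN : 2 ≤ N) (g h : Fin N → Fin N → ℝ) (hgh : ∀ x, g x x = h x x) :
    ∑ e : Fin N ≃ Fin Q × Fin L, ∑ x, ∑ y, (if (e x).1 = (e y).1 then g x y else h x y) =
      Fintype.card (Fin N ≃ Fin Q × Fin L) *
        (((L : ℝ) - 1) / (N - 1) * ∑ x, ∑ y, g x y +
          (1 - ((L : ℝ) - 1) / (N - 1)) * ∑ x, ∑ y, h x y) := by
  have hN1 : (N : ℝ) - 1 ≠ 0 := by
    have : (2 : ℝ) ≤ N := by exact_mod_cast hN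
    linarith
  rw [Finset.sum_comm, Finset.mul_sum, Finset.mul_sum, ← Finset.sum_add_distrib, Finset.mul_sum]
  refine Finset.sum_congr rfl fun x _ => ?_
  rw [Finset.sum_comm, Finset.mul_sum, Finset.mul_sum, ← Finset.sum_add_distrib, Finset.mul_sum]
  refine Finset.sum_congr rfl fun y _ => ?_
  rcases eq_or_ne x y with rfl | hxy
  · simp only [hgh, ite_self, Finset.sum_const, Finset.card_univ, nsmul_eq_mul]
    ring
  · have h1 := sum_same_block (Q := Q) (L := L) hxy
    have h2 : ∀ e : Fin N ≃ Fin Q × Fin L, (if (e x).1 = (e y).1 then g x y else h x y) =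
        h x y + (if (e x).1 = (e y).1 then (1 : ℝ) else 0) * (g x y - h x y) := fun e => by
      split_ifs <;> ring
    simp only [h2, Finset.sum_add_distrib, ← Finset.sum_mul, Finset.sum_const, Finset.card_univ,
      nsmul_eq_mul]
    rw [← mul_right_inj' hN1, mul_add, ← mul_assoc ((N : ℝ) - 1) (∑ e, _), h1]
    field_simp
    ring

end RandomBlocks

/-! ### The random block protocol and its fidelity -/

section Protocol

variable {N Q L : ℕ}

/-- The Kraus operator of Alice selecting the block `q` of the random partition `e`. -/
noncomputable def aliceBlock (p : (Fin N ≃ Fin Q × Fin L) × Fin Q) : Matrix (Fin L) (Fin N) ℂ :=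
  selector (fun l => p.1.symm (p.2, l))
    fun _ => 1 / Real.sqrt (Fintype.card (Fin N ≃ Fin Q × Fin L))

/-- The Kraus operators of Bob: either he finds the block `q`, or he finds `y` outside of this
block and moves to `|l₀⟩`. -/
noncomputable def bobBlock (l₀ : Fin L) (p : (Fin N ≃ Fin Q × Fin L) × Fin Q) :
    Option (Fin N) → Matrix (Fin L) (Fin N) ℂ
  | none => selector (fun l => p.1.symm (p.2, l)) fun _ => 1
  | some y => selector (fun _ => y) (if (p.1 y).1 = p.2 then 0 else Pi.single l₀ 1)

/-- The Kraus operators of the reset to `|l₀⟩`. -/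
noncomputable def resetTo (l₀ : Fin L) (x : Fin L) : Matrix (Fin L) (Fin L) ℂ :=
  selector (fun _ => x) (Pi.single l₀ 1)

theorem sum_block_indicator (e : Fin N ≃ Fin Q × Fin L) (q : Fin Q) (x : Fin N) (c : ℝ) :
    ∑ l, (if x = e.symm (q, l) then c else 0) = if (e x).1 = q then c else 0 := by
  have h : ∀ l, (x = e.symm (q, l)) ↔ ((e x).1 = q ∧ (e x).2 = l) := fun l => by
    rw [Equiv.eq_symm_apply, Prod.ext_iff]
  simp [h, ite_and]

theorem aliceBlock_complete (e₀ : Fin N ≃ Fin Q × Fin L) :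
    ∑ p, (aliceBlock p : Matrix (Fin L) (Fin N) ℂ)ᴴ *
      (aliceBlock (p : (Fin N ≃ Fin Q × Fin L) × Fin Q)) = 1 := by
  have hc : (Fintype.card (Fin N ≃ Fin Q × Fin L) : ℂ) ≠ 0 := by
    exact_mod_cast (Fintype.card_pos_iff.2 ⟨e₀⟩).ne'
  ext x y
  simp only [aliceBlock, conjTranspose_selector_mul_self, sum_block_indicator, Matrix.sum_apply,
    Matrix.diagonal_apply, Matrix.one_apply]
  split_ifs
  · rw [← Complex.ofReal_sum]
    simp [Fintype.sum_prod_type, hc]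
  · simp

theorem bobBlock_complete (l₀ : Fin L) (p : (Fin N ≃ Fin Q × Fin L) × Fin Q) :
    ∑ o, (bobBlock l₀ p o)ᴴ * bobBlock l₀ p o = 1 := by
  ext x y
  simp only [Fintype.sum_option, bobBlock, conjTranspose_selector_mul_self, sum_block_indicator,
    Matrix.sum_apply, Matrix.diagonal_apply, Matrix.one_apply]
  split_ifs with h1 h2
  · subst h1
    simp [← Complex.ofReal_sum, h2]
  · subst h1
    simp [← Complex.ofReal_sum, h2, ite_pow, Pi.single_apply]
  · simp

theorem resetTo_complete (l₀ : Fin L) : ∑ x, (resetTo l₀ x)ᴴ * resetTo l₀ x = 1 := by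
  ext x y
  simp only [resetTo, conjTranspose_selector_mul_self, Matrix.sum_apply, Matrix.diagonal_apply,
    Matrix.one_apply]
  split_ifs
  all_goals simp [← Complex.ofReal_sum, ite_pow, Pi.single_apply]

/-- The random block protocol: Alice chooses a random partition into blocks of size `L`, both
parties measure their blocks, and they reset to a product state if the blocks differ. -/
noncomputable def blockProtocol (e₀ : Fin N ≃ Fin Q × Fin L) (l₀ : Fin L) : LOCC L 1 N N :=
  .aliceFamily aliceBlock (aliceBlock_complete e₀) fun p =>
    .bobFamily (bobBlock l₀ p) (bobBlock_complete l₀ p) fun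
      | none => .output 0
      | some _ => .aliceFamily (resetTo l₀) (resetTo_complete l₀) fun _ => .output 0

theorem failProb_blockProtocol (e₀ : Fin N ≃ Fin Q × Fin L) (l₀ : Fin L) (ρ : BiOp N N) :
    (blockProtocol e₀ l₀).failProb ρ = 0 := by
  refine LOCC.failProb_aliceFamily _ _ _ (fun p σ => LOCC.failProb_bobFamily _ _ _ ?_ σ) ρ
  rintro (_ | y) σ
  · rfl
  · exact LOCC.failProb_aliceFamily _ _ _ (fun _ _ => rfl) σ

/-- For fixed `e`, a pair x, y in one block contributes the coherence ρ(xx, yy), and a pair in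
different blocks the probability ρ(xy, xy) of disagreement, both with weight 1/L. The two
expressions agree for x = y, so `sum_blocks` applies; their full sums are N·F(ρ) and the trace. -/
theorem outFidelity_blockProtocol (hN : 2 ≤ N) (e₀ : Fin N ≃ Fin Q × Fin L) (l₀ : Fin L)
    (ρ : BiOp N N) :
    (blockProtocol e₀ l₀).outFidelity ρ =
      1 / L * (((L : ℝ) - 1) / (N - 1) * (N * fidelity ρ) +
        (1 - ((L : ℝ) - 1) / (N - 1)) * ρ.trace.re) := by
  have hN0 : (N : ℝ) ≠ 0 := by exact_mod_cast (by omega : N ≠ 0)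
  set n : ℝ := ((Fintype.card (Fin N ≃ Fin Q × Fin L) : ℕ) : ℝ) with hn
  have hn0 : 0 < n := Nat.cast_pos.2 (Fintype.card_pos_iff.2 ⟨e₀⟩)
  have hsq : 1 / Real.sqrt n * (1 / Real.sqrt n) = 1 / n := by
    rw [div_mul_div_comm, one_mul, Real.mul_self_sqrt hn0.le]
  have hblocks := sum_blocks (Q := Q) (L := L) hN (fun x y => (ρ (x, x) (y, y)).re)
    (fun x y => (ρ (x, y) (x, y)).re) fun _ => rfl
  have htr : ρ.trace.re = ∑ x, ∑ y, (ρ (x, y) (x, y)).re := by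
    simp [Matrix.trace, Fintype.sum_prod_type]
  -- Sort the pairs by the block `q` of the first label, which is Alice's outcome; `y` inside or
  -- outside `q` matches Bob's two kinds of outcome.
  have hterm : ∀ e : Fin N ≃ Fin Q × Fin L,
      ∑ x, ∑ y, (if (e x).1 = (e y).1 then (ρ (x, x) (y, y)).re else (ρ (x, y) (x, y)).re) =
      ∑ q, ((∑ l, ∑ l', (ρ (e.symm (q, l), e.symm (q, l)) (e.symm (q, l'), e.symm (q, l'))).re) +
        ∑ y, ∑ l, if (e y).1 = q then 0
          else (ρ (e.symm (q, l), y) (e.symm (q, l), y)).re) := fun e => by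
    rw [← e.symm.sum_comp, Fintype.sum_prod_type]
    refine Finset.sum_congr rfl fun q _ => ?_
    rw [Finset.sum_comm (γ := Fin N), ← Finset.sum_add_distrib]
    refine Finset.sum_congr rfl fun l _ => ?_
    have h1 : ∀ y, (if (e (e.symm (q, l))).1 = (e y).1 then
        (ρ (e.symm (q, l), e.symm (q, l)) (y, y)).re else
          (ρ (e.symm (q, l), y) (e.symm (q, l), y)).re) =
        (if (e y).1 = q then (ρ (e.symm (q, l), e.symm (q, l)) (y, y)).re else 0) +
        if (e y).1 = q then 0 else (ρ (e.symm (q, l), y) (e.symm (q, l), y)).re := fun y => by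
      simp only [Equiv.apply_symm_apply, eq_comm (a := q)]
      split_ifs <;> simp
    rw [Finset.sum_congr rfl fun y _ => h1 y, Finset.sum_add_distrib]
    congr 1
    rw [← e.symm.sum_comp, Fintype.sum_prod_type_right]
    simp
  -- Multiplying by the number `n` of partitions cancels the probability 1/n of each, so both sides
  -- can be compared term by term in `e` and `q`.
  rw [htr, fidelity_eq_sum, ← mul_assoc (N : ℝ), mul_one_div_cancel hN0, one_mul,
    ← mul_right_inj' hn0.ne', mul_left_comm, ← hblocks, Finset.sum_congr rfl fun e _ => hterm e]
  rw [blockProtocol, LOCC.outFidelity_aliceFamily, Fintype.sum_prod_type, Finset.mul_sum,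
    Finset.mul_sum]
  refine Finset.sum_congr rfl fun e _ => ?_
  rw [Finset.mul_sum, Finset.mul_sum]
  refine Finset.sum_congr rfl fun q _ => ?_
  have hre : ∀ (c : ℝ) (z : ℂ), ((c : ℂ) * z).re = c * z.re := Complex.re_ofReal_mul
  rw [LOCC.outFidelity_bobFamily, Fintype.sum_option]
  simp only [LOCC.outFidelity_output, LOCC.outFidelity_aliceFamily, aliceBlock, bobBlock, resetTo,
    fidelity_eq_sum, alice_selector_apply, bob_selector_apply, ← hn, hsq, hre]
  rw [mul_add, mul_add]
  congr 1
  · simp only [Finset.mul_sum]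
    refine Finset.sum_congr rfl fun l _ => Finset.sum_congr rfl fun l' _ => ?_
    field_simp
  · simp only [Finset.mul_sum]
    refine Finset.sum_congr rfl fun y _ => Finset.sum_congr rfl fun l _ => ?_
    split_ifs
    · simp
    -- After both resets only the entry at `(l₀, l₀)` is left.
    · simp [Pi.single_apply]
      field_simp

end Protocol

/-! ### Part (b): tightness -/

section Tightness

theorem exists_absolutelySuccessful {N K M : ℕ} (hN : 2 ≤ N) (hK : 1 ≤ K) (hM : 1 ≤ M)
    (hMN : M ∣ N * K) (hKM : K ∣ M) :
    ∃ P : GEPP N K M, ∀ ε : ℝ, 0 ≤ ε →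
      P.AbsolutelySuccessful ε (((M : ℝ) - K) / M * ((N : ℝ) / ((N : ℝ) - 1)) * ε) := by
  obtain ⟨L, rfl⟩ := hKM
  rw [mul_comm K L] at hM hMN ⊢
  obtain ⟨Q, rfl⟩ := Nat.dvd_of_mul_dvd_mul_right hK hMN
  have hL : 1 ≤ L := Nat.pos_of_mul_pos_right hM
  let e₀ : Fin (L * Q) ≃ Fin Q × Fin L := finProdFinEquiv.symm.trans (Equiv.prodComm _ _)
  let P := blockProtocol e₀ ⟨0, hL⟩
  -- A single record means that nothing is kept: the fidelity is controlled only after averaging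
  -- over partitions and outcomes.
  refine ⟨⟨1, P.lift K⟩, fun ε _ ρ hρ hF => ?_⟩
  have hfail : (P.lift K).failProb (withAux K ρ) = 0 := by
    rw [withAux_eq_tensorAux, LOCC.failProb_lift hK]
    exact failProb_blockProtocol _ _ _
  have hprob : (P.lift K).outProb (withAux K ρ) 0 = 1 := by
    have h := (P.lift K).failProb_add_sum_outProb (withAux K ρ)
    rw [hfail, withAux_eq_tensorAux, trace_tensorAux hK, hρ.2] at h
    rw [withAux_eq_tensorAux]
    simpa using h
  have hfid := outFidelity_blockProtocol hN e₀ ⟨0, hL⟩ ρ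
  rw [← LOCC.outFidelity_lift hK, LOCC.outFidelity_apply, Fin.sum_univ_one, hρ.2] at hfid
  refine ⟨hfail, ?_⟩
  simp only [GEPP.probFidelityGE, Fin.sum_univ_one, hprob, LOCC.outState]
  rw [if_pos]
  rw [inv_one, one_smul, withAux_eq_tensorAux, hfid]
  have hN2 : (2 : ℝ) ≤ ((L * Q : ℕ) : ℝ) := by exact_mod_cast hN
  have hL1 : (1 : ℝ) ≤ L := by exact_mod_cast hL
  have hK1 : (1 : ℝ) ≤ K := by exact_mod_cast hK
  generalize ((L * Q : ℕ) : ℝ) = n at *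
  have hn : 0 < n - 1 := by linarith
  have hc : 0 ≤ ((L : ℝ) - 1) / L * (n / (n - 1)) :=
    mul_nonneg (div_nonneg (by linarith) (by linarith)) (div_nonneg (by linarith) hn.le)
  have h1 : (((L * K : ℕ) : ℝ) - K) / (L * K : ℕ) = ((L : ℝ) - 1) / L := by
    push_cast
    field_simp
  have h2 : 1 / (L : ℝ) * (((L : ℝ) - 1) / (n - 1) * (n * fidelity ρ) +
      (1 - ((L : ℝ) - 1) / (n - 1)) * (1 : ℂ).re) =
      1 - ((L : ℝ) - 1) / L * (n / (n - 1)) * (1 - fidelity ρ) := by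
    rw [Complex.one_re]
    field_simp
    ring
  rw [h1, h2]
  -- The infidelity is multiplied by a nonnegative constant independent of ε, so one protocol serves
  -- all ε.
  have := mul_le_mul_of_nonneg_left (show 1 - fidelity ρ ≤ ε by linarith) hc
  linarith

end Tightness

end Purification

theorem theorem1 (N K M : ℕ) (hN : 2 ≤ N) (hK : 1 ≤ K) (hM : 1 ≤ M) :
    (∀ ε δ : ℝ, 0 ≤ ε → ε ≤ 1 - 1 / (N : ℝ) →
      ∀ P : Purification.GEPP N K M, P.AbsolutelySuccessful ε δ →
        ((M : ℝ) - K) / M * ((N : ℝ) / ((N : ℝ) - 1)) * ε ≤ δ) ∧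
    (M ∣ N * K → K ∣ M →
      ∃ P : Purification.GEPP N K M, ∀ ε : ℝ, 0 ≤ ε →
        P.AbsolutelySuccessful ε
          (((M : ℝ) - K) / M * ((N : ℝ) / ((N : ℝ) - 1)) * ε)) :=
  ⟨fun _ _ hε hε' _ hP => hP.le_delta hN hK hM hε hε',
    Purification.exists_absolutelySuccessful hN hK hM⟩
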